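/- Let $d,n,N\ge 0$ be integers. For complex rank-$d$ tensors $\Phi=(\Phi_{i_1\cdots i_d})$, $1\le i_l\le N$, write $$\langle F\rangle=\frac{\int d\Phi\,d\bar\Phi\;e^{-\sum \Phi_{i_1\cdots i_d}\bar\Phi_{i_1\cdots i_d}}\,F(\Phi,\bar\Phi)}{\int d\Phi\,d\bar\Phi\;e^{-\sum \Phi_{i_1\cdots i_d}\bar\Phi_{i_1\cdots i_d}}}$$ for the Gaussian expectation (the denominator is finite and positive). For $\sigma_1,\dots,\sigma_d\in S_n$ let $$\mathcal O_{\sigma_1,\dots,\sigma_d}=\sum_{i^{(1)},\dots,i^{(d)}:\{1,\dots,n\}\to\{1,\dots,N\}}\ \prod_{a=1}^n \Phi_{i^{(1)}(a)\cdots i^{(d)}(a)}\,\bar\Phi_{i^{(1)}(\sigma_1(a))\cdots i^{(d)}(\sigma_d(a))}.$$ For a partition (Young diagram) $S\vdash n$ let $\chi^S$ and $d(S)$ be the character and the dimension of the corresponding irreducible complex representation $V_S$ of $S_n$, let $\mathrm{Dim}_N(S)$ be the dimension of the representation of $U(N)$ corresponding to $S$ (namely $0$ if $S$ has more than $N$ rows),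 and let $f_N(S)=\prod_{(i,j)\in S}(N-i+j)$, the product over the boxes of $S$ in row $i$ and column $j$. For $S_1,\dots,S_d\vdash n$ put $$\mathcal O_{S_1,\dots,S_d}=\frac1{(n!)^d}\sum_{\sigma_1,\dots,\sigma_d\in S_n}\chi^{S_1}(\sigma_1)\cdots\chi^{S_d}(\sigma_d)\,\mathcal O_{\sigma_1,\dots,\sigma_d},\qquad C_d(S_1,\dots,S_d)=\frac1{n!}\sum_{\gamma\in S_n}\prod_{l=1}^d\chi^{S_l}(\gamma).$$ Then all these observables are integrable against the Gaussian weight, and: 1. (Wick formula) $\displaystyle\langle\mathcal O_{\sigma_1,\dots,\sigma_d}\rangle=\sum_{\gamma\in S_n}N^{c(\gamma\sigma_1)+\cdots+c(\gamma\sigma_d)}$ for all $\sigma_1,\dots,\sigma_d\in S_n$, where $c(\alpha)$ is the number of cycles of $\alpha$, fixed points included. 2. For all $S_1,\dots,S_d\vdash n$, $$\langle\mathcal O_{S_1,\dots,S_d}\rangle=\frac1{(n!)^d}\sum_{\sigma_1,\dots,\sigma_d\in S_n}\Big[\prod_{l=1}^d\chi^{S_l}(\sigma_l)\Big]\langle\mathcal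 O_{\sigma_1,\dots,\sigma_d}\rangle=n!\,\Big[\prod_{l=1}^d\frac{\mathrm{Dim}_N(S_l)}{d(S_l)}\Big]\,C_d(S_1,\dots,S_d),$$ and $C_d(S_1,\dots,S_d)$ is the dimension of the space of $S_n$-invariants in $V_{S_1}\otimes\cdots\otimes V_{S_d}$. 3. For $d=3$ and all $S_1,S_2,S_3\vdash n$, $C_3(S_1,S_2,S_3)$ equals the Kronecker coefficient $C(S_1,S_2,S_3)$, the multiplicity of $V_{S_3}$ in $V_{S_1}\otimes V_{S_2}$, and $$\langle\mathcal O_{S_1,S_2,S_3}\rangle=n!\,\Big[\prod_{l=1}^3\frac{\mathrm{Dim}_N(S_l)}{d(S_l)}\Big]\,C(S_1,S_2,S_3)=\frac1{(n!)^2}\Big[\prod_{l=1}^3f_N(S_l)\Big]\,C(S_1,S_2,S_3).$$ -/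

import Mathlib

open scoped MonoidAlgebra BigOperators TensorProduct Nat

namespace TensorModel

noncomputable section

/-! ## Gaussian complex tensor models -/

/-- Complex tensors of rank `d`, all of whose indices take `N` values. -/
abbrev Tensor (d N : ℕ) : Type := (Fin d → Fin N) → ℂ

/-- The density `exp (- ∑ Φ_{i₁…i_d} conj Φ_{i₁…i_d})` with respect to Lebesgue measure. -/
def gaussianWeight {d N : ℕ} (Φ : Tensor d N) : ℝ :=
  Real.exp (-∑ i, ‖Φ i‖ ^ 2)

/-- `F` is integrable against the Gaussian measure `dΦ dΦ̄ exp (- ∑ Φ Φ̄)`. -/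
def GaussianIntegrable {d N : ℕ} (F : Tensor d N → ℂ) : Prop :=
  MeasureTheory.Integrable (fun Φ : Tensor d N => F Φ * (gaussianWeight Φ : ℂ))

/-- `⟨F⟩ = (∫ dΦ dΦ̄ e^{-∑ΦΦ̄} F) / (∫ dΦ dΦ̄ e^{-∑ΦΦ̄})`. -/
def expectation {d N : ℕ} (F : Tensor d N → ℂ) : ℂ :=
  (∫ Φ : Tensor d N, F Φ * (gaussianWeight Φ : ℂ)) /
    (∫ Φ : Tensor d N, (gaussianWeight Φ : ℂ))

/-- The tensor invariant `O_{σ_1,…,σ_d}`: the `l`-th index of the `a`-th `Φ` is `i l a`, the `l`-th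
index of the `a`-th `Φ̄` is `i l (σ_l a)`, and all indices are summed. -/
def permObservable {d n N : ℕ} (σ : Fin d → Equiv.Perm (Fin n)) (Φ : Tensor d N) : ℂ :=
  ∑ i : Fin d → Fin n → Fin N,
    ∏ a : Fin n, (Φ (fun l => i l a) * starRingEnd ℂ (Φ (fun l => i l (σ l a))))

/-- The number of cycles of a permutation, fixed points included. -/
def cycleCount {n : ℕ} (σ : Equiv.Perm (Fin n)) : ℕ :=
  Nat.card (Quotient (Equiv.Perm.SameCycle.setoid σ))

/-! ## Irreducible representations of the symmetric group -/

/-- Young diagrams with `n` boxes, that is, partitions of `n`. -/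
abbrev Diagram (n : ℕ) : Type := {μ : YoungDiagram // μ.card = n}

/-- A fixed numbering of the boxes of a diagram by `Fin n` (the representations below do not
depend on it up to isomorphism). -/
def tableau {n : ℕ} (S : Diagram n) : S.1.cells ≃ Fin n :=
  Finset.equivFinOfCardEq S.2

/-- Permutations of the entries that preserve each row of the tableau. -/
def rowStabilizer {n : ℕ} (S : Diagram n) : Finset (Equiv.Perm (Fin n)) :=
  {p | ∀ a, ((tableau S).symm (p a)).1.1 = ((tableau S).symm a).1.1}

/-- Permutations of the entries that preserve each column of the tableau. -/
def columnStabilizer {n : ℕ} (S : Diagram n) : Finset (Equiv.Perm (Fin n)) :=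
  {q | ∀ a, ((tableau S).symm (q a)).1.2 = ((tableau S).symm a).1.2}

/-- The Young symmetrizer `(∑_{p row} p) (∑_{q column} sgn(q) q)`. -/
def youngSymmetrizer {n : ℕ} (S : Diagram n) : ℂ[Equiv.Perm (Fin n)] :=
  (∑ p ∈ rowStabilizer S, MonoidAlgebra.of ℂ _ p) *
    ∑ q ∈ columnStabilizer S, ((Equiv.Perm.sign q : ℤ) : ℂ) • MonoidAlgebra.of ℂ _ q

/-- The Specht module of `S`: the left ideal of the group algebra generated by the Young
symmetrizer. -/
abbrev Specht {n : ℕ} (S : Diagram n) : Ideal ℂ[Equiv.Perm (Fin n)] :=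
  Ideal.span {youngSymmetrizer S}

/-- The irreducible representation of the symmetric group labelled by `S`
(left multiplication on the Specht module). -/
def spechtRep {n : ℕ} (S : Diagram n) : Representation ℂ (Equiv.Perm (Fin n)) (Specht S) :=
  Representation.ofModule' (Specht S)

/-- The irreducible character `χ^S`. -/
def chi {n : ℕ} (S : Diagram n) (σ : Equiv.Perm (Fin n)) : ℂ :=
  (spechtRep S).character σ

/-- `d(S)`, the dimension of the irreducible representation of the symmetric group. -/
def symDim {n : ℕ} (S : Diagram n) : ℕ :=
  Module.finrank ℂ (Specht S)

/-- `O_{S_1,…,S_d}`, the combination of the `O_{σ_1,…,σ_d}` weighted by characters. -/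
def charObservable {d n N : ℕ} (S : Fin d → Diagram n) (Φ : Tensor d N) : ℂ :=
  1 / (n ! : ℂ) ^ d *
    ∑ σ : Fin d → Equiv.Perm (Fin n), (∏ l, chi (S l) (σ l)) * permObservable σ Φ

/-! ## Representations of the unitary group -/

/-- The tensor power `(ℂ^N)^{⊗ n}`. -/
abbrev TensorPower (n N : ℕ) : Type := ⨂[ℂ] _ : Fin n, (Fin N → ℂ)

/-- The diagonal action of `U(N)` on `(ℂ^N)^{⊗ n}`. -/
def unitaryTensorRep (n N : ℕ) :
    Representation ℂ (Matrix.unitaryGroup (Fin N) ℂ) (TensorPower n N) where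
  toFun U := PiTensorProduct.map fun _ => Matrix.toLin' (U : Matrix (Fin N) (Fin N) ℂ)
  map_one' := by
    simp only [OneMemClass.coe_one, Matrix.toLin'_one]
    exact PiTensorProduct.map_id
  map_mul' U V := by
    simp only [Submonoid.coe_mul, Matrix.toLin'_mul]
    exact PiTensorProduct.map_comp _ _

/-- The action of the symmetric group on `(ℂ^N)^{⊗ n}` by permutation of the tensor factors. -/
def permTensorRep (n N : ℕ) :
    Representation ℂ (Equiv.Perm (Fin n)) (TensorPower n N) where
  toFun σ := (PiTensorProduct.reindex ℂ (fun _ : Fin n => Fin N → ℂ) σ).toLinearMap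
  map_one' := by
    exact LinearMap.ext fun v => by
      change PiTensorProduct.reindex ℂ (fun _ : Fin n => Fin N → ℂ) (Equiv.refl _) v = v
      rw [PiTensorProduct.reindex_refl]
      rfl
  map_mul' σ τ := by
    exact LinearMap.ext fun v =>
      (PiTensorProduct.reindex_reindex (R := ℂ) (s := fun _ : Fin n => Fin N → ℂ) τ σ v).symm

theorem unitary_perm_comm {n N : ℕ} (U : Matrix.unitaryGroup (Fin N) ℂ)
    (x : ℂ[Equiv.Perm (Fin n)]) (v : TensorPower n N) :
    unitaryTensorRep n N U ((permTensorRep n N).asAlgebraHom x v) =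
      (permTensorRep n N).asAlgebraHom x (unitaryTensorRep n N U v) := by
  induction x using MonoidAlgebra.induction_on with
  | of σ =>
    rw [Representation.asAlgebraHom_of]
    exact PiTensorProduct.map_reindex
      (fun _ : Fin n => Matrix.toLin' (U : Matrix (Fin N) (Fin N) ℂ)) σ v
  | add x y hx hy => simp [hx, hy]
  | smul r x hx => simp [hx]

/-- The representation of `U(N)` labelled by `S`, as the image of the Young symmetrizer in
`(ℂ^N)^{⊗ n}` (Schur-Weyl duality; it is zero when `S` has more than `N` rows). -/
def weylRep {n : ℕ} (N : ℕ) (S : Diagram n) : Subrepresentation (unitaryTensorRep n N) where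
  toSubmodule := LinearMap.range ((permTensorRep n N).asAlgebraHom (youngSymmetrizer S))
  apply_mem_toSubmodule U := by
    rintro _ ⟨v, rfl⟩
    exact ⟨unitaryTensorRep n N U v, (unitary_perm_comm U _ v).symm⟩

/-- `Dim_N(S)`, the dimension of the representation of `U(N)` labelled by `S`. -/
def unitaryDim {n : ℕ} (N : ℕ) (S : Diagram n) : ℕ :=
  Module.finrank ℂ (weylRep N S).toSubmodule

/-- `f_N(S) = ∏ (N - i + j)`, the product over the boxes in row `i` and column `j`. -/
def boxWeight {n : ℕ} (N : ℕ) (S : Diagram n) : ℤ :=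
  ∏ c ∈ S.1.cells, ((N : ℤ) - (c.1 : ℤ) + (c.2 : ℤ))

/-! ## Kronecker coefficients -/

/-- `C_d(S_1,…,S_d) = (1/n!) ∑_γ ∏_l χ^{S_l}(γ)`. -/
def multiKronecker {d n : ℕ} (S : Fin d → Diagram n) : ℂ :=
  1 / (n ! : ℂ) * ∑ γ : Equiv.Perm (Fin n), ∏ l, chi (S l) γ

/-- The representation of the symmetric group on `S_1 ⊗ … ⊗ S_d`. -/
def spechtTensorRep {d n : ℕ} (S : Fin d → Diagram n) :
    Representation ℂ (Equiv.Perm (Fin n)) (⨂[ℂ] l, Specht (S l)) where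
  toFun γ := PiTensorProduct.map fun l => spechtRep (S l) γ
  map_one' := by
    simp only [map_one]
    exact PiTensorProduct.map_one
  map_mul' γ γ' := by
    simp only [map_mul]
    exact PiTensorProduct.map_mul _ _

/-- The number of invariants in `S_1 ⊗ … ⊗ S_d`. -/
def invariantCount {d n : ℕ} (S : Fin d → Diagram n) : ℕ :=
  Module.finrank ℂ
    (Representation.invariants (k := ℂ) (V := ⨂[ℂ] l, Specht (S l)) (spechtTensorRep S))

/-- The Kronecker coefficient: the multiplicity of `S₃` in `S₁ ⊗ S₂`. -/
def kronecker {n : ℕ} (S₁ S₂ S₃ : Diagram n) : ℕ :=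
  Module.finrank ℂ
    (Representation.IntertwiningMap (spechtRep S₃) ((spechtRep S₁).tprod (spechtRep S₂)))

end

end TensorModel

open TensorModel

namespace TensorModel

noncomputable section

open Equiv Finset Module MeasureTheory

/-! ## Cycle counts -/

/-! The Gaussian weight factorises over the tensor entries, so a monomial with index lists `I` for
`Φ` and `J` for its conjugate has expectation equal to the number of `γ` with `J ∘ γ = I`
(`expectation_prod_mul_conj`). Summed over all index functions, this counts the `i` with each `i l`
constant on the cycles of `σ l * γ`, and a permutation with `c` cycles has `N ^ c` invariant
labellings. That is the Wick formula.

Averaging it against characters decouples the `d` slots once `γ` is fixed. In one slot, `z = ∑ N ^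
cycleCount τ • τ` is central, so its action on a Specht module is determined by its action on the
generator, the Young symmetrizer `a * b` (row sum times signed column sum). Since `a * x * b` is
always a multiple of `a * b` (`rowSum_mul_mul_columnSum`), `z` acts by a scalar, namely `∑ sgn q * N
^ cycleCount (p * q)` over row permutations `p` and column permutations `q`. Building the diagram
box by box evaluates this sum as the content product `f_N(S)` (`mul_cycleSum_insert`,
`cycleSum_univ_eq_prod`). Each slot thus contributes `f_N(S) χ^S(γ)`, and the remaining sum over `γ`
is `n! C_d`.

To pass from `f_N` to dimensions, let `m` be the scalar with `(a * b)² = m (a * b)`. The trace of a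
quasi-idempotent is `m` times its rank. On the group algebra this gives `n! = m d(S)`, and on the
tensor power it gives `f_N(S) = m Dim_N(S)` (`exists_factorial_eq_mul_symDim`). The identification
of `C_d` with a multiplicity is the usual averaging of characters. Irreducibility of the Specht
modules is never needed. -/

theorem card_comp_eq_self {n : ℕ} (σ : Perm (Fin n)) (N : ℕ) :
    Fintype.card {f : Fin n → Fin N // f ∘ σ = f} = N ^ cycleCount σ := by
  classical
  have key : ∀ (f : Fin n → Fin N), f ∘ σ = f → ∀ x y, σ.SameCycle x y → f x = f y := by
    intro f hf x y hxy
    obtain ⟨i, -, -, rfl⟩ := hxy.exists_pow_eq'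
    clear hxy
    induction i with
    | zero => simp
    | succ k ih =>
      rw [pow_succ', Perm.mul_apply]
      exact ih.trans (congrFun hf _).symm
  let e : {f : Fin n → Fin N // f ∘ σ = f} ≃ (Quotient (Perm.SameCycle.setoid σ) → Fin N) :=
    { toFun := fun f => Quotient.lift f.1 (key f.1 f.2)
      invFun := fun g => ⟨fun x => g (Quotient.mk _ x), by
        funext x
        refine congrArg g (Quotient.sound ?_)
        exact (Perm.sameCycle_apply_left.2 (Perm.SameCycle.refl σ x))⟩
      left_inv := fun f => rfl
      right_inv := fun g => by
        funext q
        induction q using Quotient.inductionOn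
        rfl }
  rw [← Nat.card_eq_fintype_card, Nat.card_congr e, Nat.card_fun, Nat.card_fin, cycleCount]

/-- Cycle counts are compared through invariant two-colourings, because `2 ^ c` determines `c`. Each
identity below thereby becomes a bijection between sets of functions. -/
theorem cycleCount_eq_of_card {n : ℕ} {σ τ : Perm (Fin n)} {k : ℕ}
    (h : Fintype.card {f : Fin n → Fin 2 // f ∘ σ = f} =
      2 ^ k * Fintype.card {f : Fin n → Fin 2 // f ∘ τ = f}) :
    cycleCount σ = k + cycleCount τ := by
  rw [card_comp_eq_self, card_comp_eq_self, ← pow_add] at h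
  exact Nat.pow_right_injective le_rfl h

theorem cycleCount_mul_comm {n : ℕ} (σ τ : Perm (Fin n)) :
    cycleCount (σ * τ) = cycleCount (τ * σ) := by
  rw [← zero_add (cycleCount (τ * σ))]
  refine cycleCount_eq_of_card ?_
  rw [pow_zero, one_mul]
  refine Fintype.card_congr
    ⟨fun f => ⟨f.1 ∘ σ, ?_⟩, fun f => ⟨f.1 ∘ τ, ?_⟩, fun f => ?_, fun f => ?_⟩
  · funext x; exact congrFun f.2 (σ x)
  · funext x; exact congrFun f.2 (τ x)
  · exact Subtype.ext f.2
  · exact Subtype.ext f.2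

theorem cycleCount_inv {n : ℕ} (σ : Perm (Fin n)) : cycleCount σ⁻¹ = cycleCount σ := by
  rw [← zero_add (cycleCount σ)]
  refine cycleCount_eq_of_card ?_
  rw [pow_zero, one_mul]
  refine Fintype.card_congr (Equiv.subtypeEquivRight fun f => ⟨fun h => ?_, fun h => ?_⟩)
  · funext x; simpa using (congrFun h (σ x)).symm
  · funext x; simpa using (congrFun h (σ⁻¹ x)).symm

/-- Multiplying by a transposition that involves a fixed point merges that point into a cycle. -/
theorem cycleCount_eq_mul_swap_add_one {n : ℕ} (g : Perm (Fin n)) {x j : Fin n} (hx : g x = x)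
    (hj : j ≠ x) : cycleCount g = 1 + cycleCount (g * swap x j) := by
  refine cycleCount_eq_of_card ?_
  -- Invariance under the product only adds the constraint `f x = f j`. As `g` fixes `x`, the colour
  -- of `x` is otherwise free, and this accounts for the factor 2.
  have fix : ∀ f : Fin n → Fin 2, f ∘ (g * swap x j) = f ↔ f ∘ g = f ∧ f x = f j := by
    intro f
    constructor
    · intro h
      have h1 : f x = f j := by simpa [hx] using congrFun h j
      refine ⟨funext fun y => ?_, h1⟩
      by_cases hyx : y = x
      · simp [hyx, hx]
      by_cases hyj : y = j
      · have := congrFun h x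
        simp only [Function.comp_apply, Perm.mul_apply, swap_apply_left] at this
        rw [hyj, Function.comp_apply, this, h1]
      · simpa [swap_apply_of_ne_of_ne hyx hyj] using congrFun h y
    · rintro ⟨h1, h2⟩
      funext y
      have h1 := congrFun h1
      simp only [Function.comp_apply] at h1
      simp only [Function.comp_apply, Perm.mul_apply, h1]
      by_cases hyx : y = x
      · simp [hyx, h2]
      by_cases hyj : y = j
      · simp [hyj, h2]
      · rw [swap_apply_of_ne_of_ne hyx hyj]
  have upd : ∀ (f : Fin n → Fin 2) (t : Fin 2), f ∘ g = f →
      Function.update f x t ∘ g = Function.update f x t := by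
    intro f t hf
    funext y
    by_cases hyx : y = x
    · simp [hyx, hx]
    · have : g y ≠ x := fun h => hyx (g.injective (h.trans hx.symm))
      simp only [Function.comp_apply, Function.update_of_ne this, Function.update_of_ne hyx]
      exact congrFun hf y
  rw [pow_one]
  let e : {f : Fin n → Fin 2 // f ∘ g = f} ≃
      Fin 2 × {f : Fin n → Fin 2 // f ∘ (g * swap x j) = f} :=
    { toFun := fun f => (f.1 x, ⟨Function.update f.1 x (f.1 j),
        (fix _).2 ⟨upd _ _ f.2, by simp [hj]⟩⟩)
      invFun := fun f => ⟨Function.update f.2.1 x f.1, upd _ _ ((fix _).1 f.2.2).1⟩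
      left_inv := fun f => Subtype.ext (by simp)
      right_inv := fun f => by
        refine Prod.ext (by simp) (Subtype.ext ?_)
        have h := ((fix _).1 f.2.2).2
        simp only [Function.update_of_ne hj, Function.update_idem]
        rw [← h, Function.update_eq_self] }
  rw [Fintype.card_congr e, Fintype.card_prod, Fintype.card_fin]

theorem swap_mul_swap_of_ne {α : Type*} [DecidableEq α] {x j k : α} (hj : j ≠ x) (hk : k ≠ x)
    (hjk : j ≠ k) : swap x j * swap x k = swap j k * swap x j := by
  ext y
  simp only [Perm.mul_apply, swap_apply_def]
  split_ifs <;> simp_all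

/-! ## Stabilizers of the fibres of a labelling -/

/-- The permutations that preserve the label `f` and move only elements of `A`. -/
def labelStabilizer {n : ℕ} (f : Fin n → ℕ) (A : Finset (Fin n)) : Finset (Perm (Fin n)) :=
  {p | ∀ a, f (p a) = f a ∧ (a ∉ A → p a = a)}

section labelStabilizer

variable {n : ℕ} {f : Fin n → ℕ} {A : Finset (Fin n)}

theorem mem_labelStabilizer {p : Perm (Fin n)} :
    p ∈ labelStabilizer f A ↔ ∀ a, f (p a) = f a ∧ (a ∉ A → p a = a) := by
  simp [labelStabilizer]

theorem labelStabilizer_mul_mem {p q : Perm (Fin n)} (hp : p ∈ labelStabilizer f A)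
    (hq : q ∈ labelStabilizer f A) : p * q ∈ labelStabilizer f A := by
  rw [mem_labelStabilizer] at *
  intro a
  refine ⟨by rw [Perm.mul_apply, (hp _).1, (hq _).1], fun ha => ?_⟩
  rw [Perm.mul_apply, (hq a).2 ha, (hp a).2 ha]

theorem labelStabilizer_inv_mem {p : Perm (Fin n)} (hp : p ∈ labelStabilizer f A) :
    p⁻¹ ∈ labelStabilizer f A := by
  rw [mem_labelStabilizer] at *
  intro a
  refine ⟨by simpa using ((hp (p⁻¹ a)).1).symm, fun ha => ?_⟩
  rw [Perm.inv_eq_iff_eq, (hp a).2 ha]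

theorem swap_mem_labelStabilizer {x y : Fin n} (hx : x ∈ A) (hy : y ∈ A) (h : f x = f y) :
    swap x y ∈ labelStabilizer f A := by
  rw [mem_labelStabilizer]
  intro a
  refine ⟨?_, fun ha => swap_apply_of_ne_of_ne (fun h => ha (h ▸ hx)) (fun h => ha (h ▸ hy))⟩
  rw [swap_apply_def]
  split_ifs with h1 h2
  · rw [h1, h]
  · rw [h2, h]
  · rfl

theorem labelStabilizer_mono {B : Finset (Fin n)} (h : A ⊆ B) :
    labelStabilizer f A ⊆ labelStabilizer f B := by
  intro p hp
  rw [mem_labelStabilizer] at *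
  exact fun a => ⟨(hp a).1, fun ha => (hp a).2 fun h' => ha (h h')⟩

theorem labelStabilizer_apply_mem {p : Perm (Fin n)} (hp : p ∈ labelStabilizer f A) {a : Fin n}
    (ha : a ∈ A) : p a ∈ A := by
  by_contra h
  have := (mem_labelStabilizer.1 hp (p a)).2 h
  exact h (by rwa [p.injective this])

/-- Coset decomposition of the stabilizer along the orbit of one element. -/
theorem sum_labelStabilizer_insert {M : Type*} [AddCommMonoid M] {x : Fin n} (hx : x ∉ A)
    (F : Perm (Fin n) → M) :
    ∑ p ∈ labelStabilizer f (insert x A), F p =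
      ∑ y ∈ insert x {y ∈ A | f y = f x}, ∑ p ∈ labelStabilizer f A, F (p * swap x y) := by
  rw [← sum_product' (f := fun y p => F (p * swap x y))]
  have hfix : ∀ p ∈ labelStabilizer f A, p x = x := fun p hp =>
    (mem_labelStabilizer.1 hp x).2 hx
  -- The coset of `p` is recorded by `y = p⁻¹ x`; then `p * swap x y` fixes `x` and hence lies in
  -- the smaller stabilizer.
  refine Finset.sum_bij' (fun p _ => (p⁻¹ x, p * swap x (p⁻¹ x)))
    (fun a _ => a.2 * swap x a.1) ?_ ?_ ?_ ?_ ?_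
  · intro p hp
    have hy := labelStabilizer_apply_mem (labelStabilizer_inv_mem hp) (mem_insert_self x A)
    have hfy := (mem_labelStabilizer.1 (labelStabilizer_inv_mem hp) x).1
    rw [mem_product]
    constructor
    · rw [mem_insert, mem_filter]
      rcases mem_insert.1 hy with h | h
      · exact Or.inl h
      · exact Or.inr ⟨h, hfy⟩
    · have hm := labelStabilizer_mul_mem hp
        (swap_mem_labelStabilizer (mem_insert_self x A) hy hfy.symm)
      rw [mem_labelStabilizer] at hm ⊢
      refine fun a => ⟨(hm a).1, fun ha => ?_⟩
      by_cases hax : a = x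
      · simp [hax]
      · exact (hm a).2 (by simp [hax, ha])
  · rintro ⟨y, p⟩ hp
    rw [mem_product] at hp
    refine labelStabilizer_mul_mem (labelStabilizer_mono (subset_insert x A) hp.2) ?_
    rcases mem_insert.1 hp.1 with h | h
    · exact swap_mem_labelStabilizer (mem_insert_self x A) (mem_insert.2 (Or.inl h))
        (congrArg f h).symm
    · have h := mem_filter.1 h
      exact swap_mem_labelStabilizer (mem_insert_self x A) (mem_insert_of_mem h.1) h.2.symm
  · intro p _
    simp [mul_assoc]
  · rintro ⟨y, p⟩ hp
    have h : (p * swap x y)⁻¹ x = y := by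
      rw [Perm.inv_eq_iff_eq]
      simp [hfix p (mem_product.1 hp).2]
    simp only [h, mul_assoc, swap_mul_self, mul_one]
  · intro p _
    simp [mul_assoc]

theorem sum_labelStabilizer_insert' {M : Type*} [AddCommMonoid M] {x : Fin n} (hx : x ∉ A)
    (F : Perm (Fin n) → M) :
    ∑ p ∈ labelStabilizer f (insert x A), F p =
      ∑ y ∈ insert x {y ∈ A | f y = f x}, ∑ p ∈ labelStabilizer f A, F (swap x y * p) := by
  have hinv : ∀ (B : Finset (Fin n)) (G : Perm (Fin n) → M),
      ∑ p ∈ labelStabilizer f B, G p = ∑ p ∈ labelStabilizer f B, G p⁻¹ := fun B G =>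
    Finset.sum_nbij' (·⁻¹) (·⁻¹) (fun _ => labelStabilizer_inv_mem)
      (fun _ => labelStabilizer_inv_mem) (by simp) (by simp) (by simp)
  rw [hinv, sum_labelStabilizer_insert hx]
  refine sum_congr rfl fun y _ => ?_
  rw [hinv]
  simp

theorem sum_labelStabilizer_mul_right {M : Type*} [AddCommMonoid M] {s : Perm (Fin n)}
    (hs : s ∈ labelStabilizer f A) (F : Perm (Fin n) → M) :
    ∑ p ∈ labelStabilizer f A, F (p * s) = ∑ p ∈ labelStabilizer f A, F p :=
  Finset.sum_nbij' (· * s) (· * s⁻¹) (fun _ h => labelStabilizer_mul_mem h hs)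
    (fun _ h => labelStabilizer_mul_mem h (labelStabilizer_inv_mem hs))
    (by simp) (by simp) (by simp)

theorem sum_labelStabilizer_mul_left {M : Type*} [AddCommMonoid M] {s : Perm (Fin n)}
    (hs : s ∈ labelStabilizer f A) (F : Perm (Fin n) → M) :
    ∑ p ∈ labelStabilizer f A, F (s * p) = ∑ p ∈ labelStabilizer f A, F p :=
  Finset.sum_nbij' (s * ·) (s⁻¹ * ·) (fun _ h => labelStabilizer_mul_mem hs h)
    (fun _ h => labelStabilizer_mul_mem (labelStabilizer_inv_mem hs) h)
    (by simp) (by simp) (by simp)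

end labelStabilizer

/-! ## The content product -/

section content

variable {n : ℕ} {r c : Fin n → ℕ} {R : Type*} [CommRing R]

/-- The sum of `sgn q X ^ cycleCount (p q)` over the row and column permutations of `A`. -/
def cycleSum (r c : Fin n → ℕ) (X : R) (A : Finset (Fin n)) : R :=
  ∑ p ∈ labelStabilizer r A, ∑ q ∈ labelStabilizer c A,
    ((Perm.sign q : ℤ) : R) * X ^ cycleCount (p * q)

/-- The box `m` shares its row with `k` and its column with `j`. Replacing `p` by `p * swap k m` and
`q` by `swap j m * q` leaves the product unchanged, since `swap k m * swap j k * swap j m = swap j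
k`, but flips the sign of `q`. The sum is therefore its own negative. -/
theorem sum_cycleCount_eq_zero [NoZeroDivisors R] [CharZero R] (X : R) {A : Finset (Fin n)}
    {j k m : Fin n} (hj : j ∈ A) (hk : k ∈ A) (hm : m ∈ A) (hmk : r m = r k) (hmj : c m = c j)
    (hjm : j ≠ m) (hkm : k ≠ m) (hjk : j ≠ k) :
    ∑ p ∈ labelStabilizer r A, ∑ q ∈ labelStabilizer c A,
      ((Perm.sign q : ℤ) : R) * X ^ cycleCount (p * swap j k * q) = 0 := by
  rw [← self_eq_neg]
  conv_lhs => rw [← sum_labelStabilizer_mul_right (swap_mem_labelStabilizer hk hm hmk.symm)]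
  rw [← sum_neg_distrib]
  refine sum_congr rfl fun p _ => ?_
  conv_lhs => rw [← sum_labelStabilizer_mul_left (swap_mem_labelStabilizer hj hm hmj.symm)]
  rw [← sum_neg_distrib]
  refine sum_congr rfl fun q _ => ?_
  have : p * swap k m * swap j k * (swap j m * q) = p * swap j k * q := by
    have h : swap k m * swap j k * swap j m = swap j k := by
      rw [swap_comm k m, swap_comm j k, swap_comm j m]
      ext y
      simp only [Perm.mul_apply, swap_apply_def]
      split_ifs <;> simp_all
    simp only [mul_assoc] at h ⊢
    rw [← mul_assoc (swap j k) (swap j m) q, ← mul_assoc (swap k m), h]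
  rw [this, Perm.sign_mul, Perm.sign_swap hjm]
  simp

/-- Split both stabilizers into cosets of those that fix `x`, with representatives `swap x j` and
`swap x k`. When both are trivial the old sum returns. A row swap alone merges `x` into a cycle and
costs one factor `X`; a column swap alone does the same with a sign. When both are nontrivial the
terms cancel, by the box completing the rectangle. -/
theorem mul_cycleSum_insert [NoZeroDivisors R] [CharZero R] (X : R) {A : Finset (Fin n)}
    {x : Fin n} (hx : x ∉ A) (hinj : ∀ a b, r a = r b → c a = c b → a = b)
    (hcorner : ∀ j ∈ A, ∀ k ∈ A, r j = r x → c k = c x → ∃ m ∈ A, r m = r k ∧ c m = c j) :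
    X * cycleSum r c X (insert x A) =
      (X + (#{y ∈ A | r y = r x} : R) - (#{y ∈ A | c y = c x} : R)) * cycleSum r c X A := by
  have ne : ∀ {j}, j ∈ A → j ≠ x := fun hj h => hx (h ▸ hj)
  have fixr : ∀ {p}, p ∈ labelStabilizer r A → p x = x := fun hp =>
    (mem_labelStabilizer.1 hp x).2 hx
  have fixc : ∀ {p}, p ∈ labelStabilizer c A → p x = x := fun hp =>
    (mem_labelStabilizer.1 hp x).2 hx
  -- the contribution of a pair of coset representatives
  let T : Fin n → Fin n → R := fun j k =>
    ∑ p ∈ labelStabilizer r A, ∑ q ∈ labelStabilizer c A,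
      ((Perm.sign (swap x k * q) : ℤ) : R) * X ^ cycleCount (p * swap x j * (swap x k * q))
  have merge : ∀ {p q : Perm (Fin n)} {j : Fin n}, p x = x → q x = x → j ≠ x →
      X * X ^ cycleCount (p * swap x j * q) = X ^ cycleCount (p * q) := by
    intro p q j hp hq hj
    rw [cycleCount_mul_comm, cycleCount_mul_comm p q, ← mul_assoc q,
      cycleCount_eq_mul_swap_add_one (q * p) (by simp [hp, hq]) hj, pow_add, pow_one]
  have T00 : T x x = cycleSum r c X A := by
    simp only [T, cycleSum, swap_self, ← Perm.one_def, one_mul, mul_one]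
  have T10 : ∀ j ∈ A, X * T j x = cycleSum r c X A := by
    intro j hj
    simp only [T, cycleSum, mul_sum]
    refine sum_congr rfl fun p hp => sum_congr rfl fun q hq => ?_
    rw [← merge (fixr hp) (fixc hq) (ne hj)]
    simp only [swap_self, ← Perm.one_def, one_mul]
    ring
  have T01 : ∀ k ∈ A, X * T x k = -cycleSum r c X A := by
    intro k hk
    simp only [T, cycleSum, mul_sum, ← sum_neg_distrib]
    refine sum_congr rfl fun p hp => sum_congr rfl fun q hq => ?_
    rw [← merge (fixr hp) (fixc hq) (ne hk), Perm.sign_mul, Perm.sign_swap (ne hk).symm]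
    simp only [swap_self, ← Perm.one_def, mul_one, ← mul_assoc]
    push_cast
    ring
  have T11 : ∀ j ∈ A, r j = r x → ∀ k ∈ A, c k = c x → X * T j k = 0 := by
    intro j hj hjx k hk hkx
    have hjk : j ≠ k := by
      rintro rfl
      exact ne hj (hinj _ _ hjx hkx)
    obtain ⟨m, hm, hmk, hmj⟩ := hcorner j hj k hk hjx hkx
    have hjm : j ≠ m := by
      rintro rfl
      exact ne hk (hinj _ _ (hmk.symm.trans hjx) hkx)
    have hkm : k ≠ m := by
      rintro rfl
      exact ne hj (hinj _ _ hjx (hmj.symm.trans hkx))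
    rw [← neg_zero, ← sum_cycleCount_eq_zero X hj hk hm hmk hmj hjm hkm hjk]
    simp only [T, mul_sum, ← sum_neg_distrib]
    refine sum_congr rfl fun p hp => sum_congr rfl fun q hq => ?_
    have h1 : p * swap x j * (swap x k * q) = (p * swap j k) * swap x j * q := by
      rw [← mul_assoc, mul_assoc p, swap_mul_swap_of_ne (ne hj) (ne hk) hjk, ← mul_assoc]
    have h2 : (p * swap j k) x = x := by
      rw [Perm.mul_apply, swap_apply_of_ne_of_ne (ne hj).symm (ne hk).symm, fixr hp]
    rw [h1, ← merge h2 (fixc hq) (ne hj), Perm.sign_mul, Perm.sign_swap (ne hk).symm]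
    push_cast
    ring
  have expand : cycleSum r c X (insert x A) =
      ∑ j ∈ insert x {y ∈ A | r y = r x}, ∑ k ∈ insert x {y ∈ A | c y = c x}, T j k := by
    rw [cycleSum, sum_labelStabilizer_insert hx]
    refine sum_congr rfl fun j _ => ?_
    simp only [sum_labelStabilizer_insert' hx]
    rw [sum_comm]
  rw [expand, sum_insert (by simp [hx]), sum_insert (by simp [hx]), mul_add, mul_add,
    mul_sum {y ∈ A | c y = c x}, sum_congr rfl fun k hk => T01 k (mem_filter.1 hk).1]
  rw [mul_sum {y ∈ A | r y = r x}, sum_congr rfl fun j hj =>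
    (show X * ∑ k ∈ insert x {y ∈ A | c y = c x}, T j k =
    cycleSum r c X A from by
      rw [sum_insert (by simp [hx]), mul_add, T10 j (mem_filter.1 hj).1, mul_sum,
        sum_eq_zero fun k hk => T11 j (mem_filter.1 hj).1 (mem_filter.1 hj).2 k
          (mem_filter.1 hk).1 (mem_filter.1 hk).2, add_zero])]
  rw [sum_const, sum_const, T00]
  simp only [nsmul_eq_mul]
  ring

/-- Points outside `A` are fixed but still count as cycles; the powers of `X` on the two sides
account for them without a subtraction in the exponent. -/
theorem pow_mul_cycleSum [NoZeroDivisors R] [CharZero R] (X : R)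
    (hinj : ∀ a b, r a = r b → c a = c b → a = b)
    (hfull : ∀ a i j, i ≤ r a → j ≤ c a → ∃ b, r b = i ∧ c b = j) (A : Finset (Fin n))
    (hA : ∀ a ∈ A, ∀ b, r b ≤ r a → c b ≤ c a → b ∈ A) :
    X ^ #A * cycleSum r c X A = X ^ n * ∏ a ∈ A, (X - (r a : R) + (c a : R)) := by
  induction hs : #A generalizing A with
  | zero =>
    rw [card_eq_zero] at hs
    subst hs
    have h1 : ∀ f : Fin n → ℕ, labelStabilizer f ∅ = {1} := by
      intro f
      ext p
      rw [mem_labelStabilizer, mem_singleton]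
      exact ⟨fun h => Equiv.ext fun a => (h a).2 (by simp), by rintro rfl; simp⟩
    have h2 : cycleCount (1 : Perm (Fin n)) = n := by
      have h := card_comp_eq_self (1 : Perm (Fin n)) 2
      have h' : Fintype.card {f : Fin n → Fin 2 // f ∘ (1 : Perm (Fin n)) = f} = 2 ^ n := by
        rw [Fintype.card_congr (Equiv.subtypeUnivEquiv fun f => by rfl)]
        simp
      exact Nat.pow_right_injective le_rfl (h.symm.trans h')
    simp [cycleSum, h1, h2]
  | succ s ih =>
    -- A box with maximal row plus column is a removable corner: the rest of `A` is still closed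
    -- under moving up and left.
    obtain ⟨x, hxA, hmax⟩ := A.exists_max_image (fun a => r a + c a) (card_pos.1 (by omega))
    have hxe : x ∉ A.erase x := notMem_erase x A
    have hlow : ∀ a ∈ A.erase x, ∀ b, r b ≤ r a → c b ≤ c a → b ∈ A.erase x := by
      intro a ha b h1 h2
      refine mem_erase.2 ⟨?_, hA a (mem_of_mem_erase ha) b h1 h2⟩
      rintro rfl
      have := hmax a (mem_of_mem_erase ha)
      exact ne_of_mem_erase ha (hinj _ _ (by omega) (by omega))
    have hcorner : ∀ j ∈ A.erase x, ∀ k ∈ A.erase x, r j = r x → c k = c x →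
        ∃ m ∈ A.erase x, r m = r k ∧ c m = c j := by
      intro j hj k hk hjx hkx
      have h1 := hmax j (mem_of_mem_erase hj)
      obtain ⟨m, hm1, hm2⟩ := hfull k (r k) (c j) le_rfl (by omega)
      exact ⟨m, hlow k hk m hm1.le (by omega), hm1, hm2⟩
    have hrow : #{y ∈ A.erase x | r y = r x} = c x := by
      rw [← card_range (c x)]
      refine card_bij (fun a _ => c a) ?_ ?_ ?_
      · intro a ha
        obtain ⟨ha, har⟩ := mem_filter.1 ha
        have := hmax a (mem_of_mem_erase ha)
        have : c a ≠ c x := fun h => ne_of_mem_erase ha (hinj _ _ har h)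
        rw [mem_range]
        omega
      · intro a ha b hb h
        exact hinj _ _ ((mem_filter.1 ha).2.trans (mem_filter.1 hb).2.symm) h
      · intro i hi
        rw [mem_range] at hi
        obtain ⟨b, hb1, hb2⟩ := hfull x (r x) i le_rfl hi.le
        refine ⟨b, mem_filter.2 ⟨mem_erase.2 ⟨?_, hA x hxA b hb1.le (by omega)⟩, hb1⟩, hb2⟩
        rintro rfl
        omega
    have hcol : #{y ∈ A.erase x | c y = c x} = r x := by
      rw [← card_range (r x)]
      refine card_bij (fun a _ => r a) ?_ ?_ ?_
      · intro a ha
        obtain ⟨ha, hac⟩ := mem_filter.1 ha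
        have := hmax a (mem_of_mem_erase ha)
        have : r a ≠ r x := fun h => ne_of_mem_erase ha (hinj _ _ h hac)
        rw [mem_range]
        omega
      · intro a ha b hb h
        exact hinj _ _ h ((mem_filter.1 ha).2.trans (mem_filter.1 hb).2.symm)
      · intro i hi
        rw [mem_range] at hi
        obtain ⟨b, hb1, hb2⟩ := hfull x i (c x) hi.le le_rfl
        refine ⟨b, mem_filter.2 ⟨mem_erase.2 ⟨?_, hA x hxA b (by omega) hb2.le⟩, hb2⟩, hb1⟩
        rintro rfl
        omega
    have hstep := mul_cycleSum_insert X hxe hinj hcorner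
    rw [insert_erase hxA, hrow, hcol] at hstep
    rw [pow_succ, mul_assoc, hstep, mul_left_comm,
      ih (A.erase x) hlow (by rw [card_erase_of_mem hxA, hs]; rfl), ← mul_prod_erase A _ hxA]
    ring

/-- The content product formula. -/
theorem cycleSum_univ_eq_prod (N : R)
    (hinj : ∀ a b, r a = r b → c a = c b → a = b)
    (hfull : ∀ a i j, i ≤ r a → j ≤ c a → ∃ b, r b = i ∧ c b = j) :
    cycleSum r c N univ = ∏ a, (N - (r a : R) + (c a : R)) := by
  -- Working with an indeterminate allows `X ^ n` to be cancelled; the value specialised afterwards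
  -- may be 0.
  have h := pow_mul_cycleSum (Polynomial.X : Polynomial ℤ) hinj hfull univ (by simp)
  rw [card_univ, Fintype.card_fin] at h
  have h := mul_left_cancel₀ (pow_ne_zero _ Polynomial.X_ne_zero) h
  have h := congrArg (Polynomial.eval₂ (Int.castRingHom R) N) h
  have hint (z : ℤ) : Polynomial.eval₂ (Int.castRingHom R) N (z : Polynomial ℤ) = z := by
    simpa using Polynomial.eval₂_C (Int.castRingHom R) N (a := z)
  simpa [cycleSum, Polynomial.eval₂_finsetSum, Polynomial.eval₂_finsetProd, hint] using h

end content

/-! ## Young symmetrizers -/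

section symmetrizer

variable {n : ℕ} {r c : Fin n → ℕ}

/-- If the columns of a diagram are relabelled by `h` so that no two elements share both labels, then
the pairs of labels still lie in the diagram. -/
theorem exists_label_eq
    (hfull : ∀ a i j, i ≤ r a → j ≤ c a → ∃ b, r b = i ∧ c b = j) (h : Perm (Fin n))
    (hh : ∀ x y, r x = r y → c (h x) = c (h y) → x = y) (x : Fin n) :
    ∃ b, r b = r x ∧ c b = c (h x) := by
  obtain ⟨y, hy, hmax⟩ := exists_max_image ({y | r y = r x} : Finset (Fin n)) c ⟨x, by simp⟩
  have hy : r y = r x := by simpa using hy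
  have hmax : ∀ z, r z = r x → c z ≤ c y := by simpa using hmax
  suffices hx : c (h x) < c y + 1 from hfull y (r x) (c (h x)) hy.ge (by omega)
  -- In each row the relabelled columns are distinct, so at most `min k (row length)` of them lie
  -- below `k`, and the original columns attain this bound. The totals over all rows agree because
  -- `h` is a bijection, so equality holds row by row; `k = c y + 1` is the length of the row of
  -- `x`.
  have hle : ∀ k, ∀ i ∈ univ.image r,
      #{z ∈ {z : Fin n | c (h z) < k} | r z = i} ≤ #{z ∈ {z : Fin n | c z < k} | r z = i} := by
    intro k i _
    by_cases hk : ∃ z, r z = i ∧ k ≤ c z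
    · obtain ⟨z, hz, hkz⟩ := hk
      calc #{z ∈ {z : Fin n | c (h z) < k} | r z = i}
          ≤ #(range k) := by
            refine card_le_card_of_injOn (fun z => c (h z)) (fun z hz => ?_) fun a ha b hb hab => ?_
            · simp only [coe_filter, mem_filter, mem_univ, true_and, Set.mem_ofPred_eq] at hz
              simpa using hz.1
            · simp only [coe_filter, mem_filter, mem_univ, true_and, Set.mem_ofPred_eq] at ha hb
              exact hh _ _ (ha.2.trans hb.2.symm) hab
        _ ≤ #((filter (fun z => r z = i) {z : Fin n | c z < k}).image c) := by
            refine card_le_card fun j hj => ?_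
            rw [mem_range] at hj
            obtain ⟨b, hb, hbj⟩ := hfull z i j hz.ge (by omega)
            exact mem_image.2 ⟨b, by simp [hb, hbj, hj], hbj⟩
        _ ≤ _ := card_image_le
    · push Not at hk
      refine card_le_card fun z hz => ?_
      simp only [mem_filter, mem_univ, true_and] at hz ⊢
      exact ⟨hk z hz.2, hz.2⟩
  have htot : ∀ k, #{z : Fin n | c (h z) < k} = #{z : Fin n | c z < k} := by
    intro k
    refine card_bij (fun z _ => h z) (by simp) (by simp)
      fun z hz => ⟨h.symm z, by simpa using hz, by simp⟩
  have hcard := htot (c y + 1)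
  rw [card_eq_sum_card_fiberwise (t := univ.image r) (f := r) (by simp [Set.MapsTo]),
    card_eq_sum_card_fiberwise (t := univ.image r) (f := r) (by simp [Set.MapsTo])] at hcard
  have heq := (sum_eq_sum_iff_of_le (hle (c y + 1))).1 hcard (r x) (by simp)
  have hsub : filter (fun z => r z = r x) {z : Fin n | c (h z) < c y + 1} ⊆
      filter (fun z => r z = r x) {z : Fin n | c z < c y + 1} := by
    intro z hz
    simp only [mem_filter, mem_univ, true_and] at hz ⊢
    have := hmax z hz.2
    exact ⟨by omega, hz.2⟩
  have hmem : x ∈ filter (fun z => r z = r x) {z : Fin n | c z < c y + 1} := by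
    have := hmax x rfl
    simp only [mem_filter, mem_univ, true_and]
    exact ⟨by omega, trivial⟩
  rw [← eq_of_subset_of_card_le hsub heq.ge] at hmem
  simpa using hmem

/-- Unless two entries of a row come from one column under `g⁻¹`, sending `x` to the box in the row
of `x` and the column of `g⁻¹ x` is a well-defined row permutation `β`. Then `β * g` preserves
columns, and `g = β⁻¹ * (β * g)`. -/
theorem exists_mul_eq_or_exists_swap
    (hfull : ∀ a i j, i ≤ r a → j ≤ c a → ∃ b, r b = i ∧ c b = j) (g : Perm (Fin n)) :
    (∃ p ∈ labelStabilizer r univ, ∃ q ∈ labelStabilizer c univ, g = p * q) ∨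
      ∃ x y, x ≠ y ∧ r x = r y ∧ c (g⁻¹ x) = c (g⁻¹ y) := by
  by_cases hg : ∃ x y, x ≠ y ∧ r x = r y ∧ c (g⁻¹ x) = c (g⁻¹ y)
  · exact Or.inr hg
  · refine Or.inl ?_
    push Not at hg
    have hh : ∀ x y, r x = r y → c (g⁻¹ x) = c (g⁻¹ y) → x = y := fun x y h1 h2 => by
      by_contra hxy
      exact hg x y hxy h1 h2
    choose B hBr hBc using exists_label_eq hfull g⁻¹ hh
    have hB : Function.Injective B := fun x y hxy =>
      hh x y (by rw [← hBr x, ← hBr y, hxy]) (by rw [← hBc x, ← hBc y, hxy])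
    let β : Perm (Fin n) := Equiv.ofBijective B (Finite.injective_iff_bijective.1 hB)
    refine ⟨β⁻¹, labelStabilizer_inv_mem ?_, β * g, ?_, by simp⟩
    · exact mem_labelStabilizer.2 fun a => ⟨hBr a, by simp⟩
    · refine mem_labelStabilizer.2 fun a => ⟨?_, by simp⟩
      exact (hBc (g a)).trans (by simp)

/-- The sum of the permutations that preserve the labels `r`. -/
def rowSum (r : Fin n → ℕ) : ℂ[Perm (Fin n)] :=
  ∑ p ∈ labelStabilizer r univ, MonoidAlgebra.of ℂ _ p

/-- The signed sum of the permutations that preserve the labels `c`. -/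
def columnSum (c : Fin n → ℕ) : ℂ[Perm (Fin n)] :=
  ∑ q ∈ labelStabilizer c univ, ((Perm.sign q : ℤ) : ℂ) • MonoidAlgebra.of ℂ _ q

theorem rowSum_mul_of {s : Perm (Fin n)} (hs : s ∈ labelStabilizer r univ) :
    rowSum r * MonoidAlgebra.of ℂ _ s = rowSum r := by
  rw [rowSum, sum_mul]
  simp only [← map_mul]
  exact sum_labelStabilizer_mul_right hs _

theorem of_mul_columnSum {s : Perm (Fin n)} (hs : s ∈ labelStabilizer c univ) :
    MonoidAlgebra.of ℂ _ s * columnSum c = ((Perm.sign s : ℤ) : ℂ) • columnSum c := by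
  rw [columnSum, mul_sum, smul_sum, ← sum_labelStabilizer_mul_left hs
    (fun q => ((Perm.sign s : ℤ) : ℂ) • ((Perm.sign q : ℤ) : ℂ) • MonoidAlgebra.of ℂ _ q)]
  refine sum_congr rfl fun q _ => ?_
  rw [mul_smul_comm, ← map_mul, smul_smul, Perm.sign_mul]
  congr 1
  push_cast
  rw [← mul_assoc, ← Int.cast_mul, ← Units.val_mul, Int.units_mul_self]
  simp

theorem rowSum_mul_columnSum : rowSum r * columnSum c =
    ∑ p ∈ labelStabilizer r univ, ∑ q ∈ labelStabilizer c univ,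
      ((Perm.sign q : ℤ) : ℂ) • MonoidAlgebra.of ℂ _ (p * q) := by
  simp only [rowSum, columnSum, sum_mul_sum, mul_smul_comm, map_mul]

/-- Only the identity preserves both rows and columns, so `p * q = 1` forces `p = q = 1`. -/
theorem coeff_rowSum_mul_columnSum_one (hinj : ∀ a b, r a = r b → c a = c b → a = b) :
    (rowSum r * columnSum c).coeff 1 = 1 := by
  have h1 : ∀ f : Fin n → ℕ, (1 : Perm (Fin n)) ∈ labelStabilizer f univ := fun f =>
    mem_labelStabilizer.2 (by simp)
  have h2 : ∀ p ∈ labelStabilizer r univ, ∀ q ∈ labelStabilizer c univ, p * q = 1 → q = 1 := by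
    intro p hp q hq h
    refine Equiv.ext fun a => hinj _ _ ?_ (mem_labelStabilizer.1 hq a).1
    rw [← (mem_labelStabilizer.1 hp (q a)).1, ← Perm.mul_apply, h]
  rw [rowSum_mul_columnSum, MonoidAlgebra.coeff_sum, Finsupp.finsetSum_apply,
    sum_eq_single_of_mem 1 (h1 r), MonoidAlgebra.coeff_sum, Finsupp.finsetSum_apply,
    sum_eq_single_of_mem 1 (h1 c)]
  · simp
  · intro q hq hq1
    have : (1 : Perm (Fin n)) * q ≠ 1 := fun h => hq1 (h2 1 (h1 r) q hq h)
    simp only [MonoidAlgebra.coeff_smul, MonoidAlgebra.of_apply, MonoidAlgebra.coeff_single,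
      Finsupp.smul_apply, Finsupp.single_eq_of_ne this.symm, smul_zero]
  · intro p hp hp1
    rw [MonoidAlgebra.coeff_sum, Finsupp.finsetSum_apply]
    refine sum_eq_zero fun q hq => ?_
    have : p * q ≠ 1 := fun h => hp1 (by simpa [h2 p hp q hq h] using h)
    simp only [MonoidAlgebra.coeff_smul, MonoidAlgebra.of_apply, MonoidAlgebra.coeff_single,
      Finsupp.smul_apply, Finsupp.single_eq_of_ne this.symm, smul_zero]

theorem rowSum_mul_mul_columnSum (hinj : ∀ a b, r a = r b → c a = c b → a = b)
    (hfull : ∀ a i j, i ≤ r a → j ≤ c a → ∃ b, r b = i ∧ c b = j) (x : ℂ[Perm (Fin n)]) :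
    rowSum r * x * columnSum c =
      (rowSum r * x * columnSum c).coeff 1 • (rowSum r * columnSum c) := by
  suffices h : ∃ k : ℂ, rowSum r * x * columnSum c = k • (rowSum r * columnSum c) by
    obtain ⟨k, hk⟩ := h
    rw [hk, MonoidAlgebra.coeff_smul, Finsupp.smul_apply, coeff_rowSum_mul_columnSum_one hinj,
      smul_eq_mul, mul_one]
  induction x using MonoidAlgebra.induction_on with
  | of g =>
    rcases exists_mul_eq_or_exists_swap hfull g with ⟨p, hp, q, hq, rfl⟩ | ⟨x, y, hxy, hr, hc⟩
    · refine ⟨((Perm.sign q : ℤ) : ℂ), ?_⟩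
      rw [map_mul, ← mul_assoc, rowSum_mul_of hp, mul_assoc, of_mul_columnSum hq, mul_smul_comm]
    · refine ⟨0, ?_⟩
      have hs : swap x y ∈ labelStabilizer r univ :=
        swap_mem_labelStabilizer (mem_univ _) (mem_univ _) hr
      have ht : swap (g⁻¹ x) (g⁻¹ y) ∈ labelStabilizer c univ :=
        swap_mem_labelStabilizer (mem_univ _) (mem_univ _) hc
      -- A row transposition absorbed on the left becomes, after passing through `g`, a column
      -- transposition absorbed on the right with sign -1; the product therefore vanishes.
      have hst : swap x y * g = g * swap (g⁻¹ x) (g⁻¹ y) := by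
        rw [mul_swap_eq_swap_mul]
        simp
      have hneg : rowSum r * MonoidAlgebra.of ℂ _ g * columnSum c =
          -(rowSum r * MonoidAlgebra.of ℂ _ g * columnSum c) := by
        conv_lhs => rw [← rowSum_mul_of hs, mul_assoc (rowSum r), ← map_mul, hst, map_mul,
          ← mul_assoc, mul_assoc, of_mul_columnSum ht,
          Perm.sign_swap (fun h => hxy (g⁻¹.injective h))]
        simp
      rw [zero_smul]
      have htwo : (2 : ℂ) • (rowSum r * MonoidAlgebra.of ℂ _ g * columnSum c) = 0 := by
        rw [two_smul]
        nth_rewrite 1 [hneg]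
        exact neg_add_cancel _
      exact (smul_eq_zero.1 htwo).resolve_left two_ne_zero
  | add x y hx hy =>
    obtain ⟨k, hk⟩ := hx
    obtain ⟨l, hl⟩ := hy
    exact ⟨k + l, by rw [mul_add, add_mul, hk, hl, add_smul]⟩
  | smul t x hx =>
    obtain ⟨k, hk⟩ := hx
    exact ⟨t * k, by rw [mul_smul_comm, smul_mul_assoc, hk, smul_smul]⟩

end symmetrizer

/-! ## The tableau of a diagram -/

section tableau

variable {n : ℕ} (S : Diagram n)

/-- The row of an entry of the tableau. -/
def rowLabel (a : Fin n) : ℕ := ((tableau S).symm a).1.1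

/-- The column of an entry of the tableau. -/
def columnLabel (a : Fin n) : ℕ := ((tableau S).symm a).1.2

theorem label_injective (a b : Fin n) (hr : rowLabel S a = rowLabel S b)
    (hc : columnLabel S a = columnLabel S b) : a = b :=
  (tableau S).symm.injective (Subtype.ext (Prod.ext hr hc))

theorem exists_label (a : Fin n) (i j : ℕ) (hi : i ≤ rowLabel S a) (hj : j ≤ columnLabel S a) :
    ∃ b, rowLabel S b = i ∧ columnLabel S b = j := by
  have hm : (i, j) ∈ S.1 := S.1.up_left_mem hi hj ((tableau S).symm a).2
  exact ⟨tableau S ⟨(i, j), hm⟩, by simp [rowLabel], by simp [columnLabel]⟩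

theorem youngSymmetrizer_eq :
    youngSymmetrizer S = rowSum (rowLabel S) * columnSum (columnLabel S) := by
  have h1 : rowStabilizer S = labelStabilizer (rowLabel S) univ := by
    ext p; simp [rowStabilizer, labelStabilizer, rowLabel]
  have h2 : columnStabilizer S = labelStabilizer (columnLabel S) univ := by
    ext p; simp [columnStabilizer, labelStabilizer, columnLabel]
  rw [youngSymmetrizer, h1, h2, rowSum, columnSum]

theorem coeff_youngSymmetrizer_one : (youngSymmetrizer S).coeff 1 = 1 := by
  rw [youngSymmetrizer_eq, coeff_rowSum_mul_columnSum_one (label_injective S)]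

theorem youngSymmetrizer_mul_self :
    ∃ m : ℂ, youngSymmetrizer S * youngSymmetrizer S = m • youngSymmetrizer S := by
  rw [youngSymmetrizer_eq]
  have h := rowSum_mul_mul_columnSum (label_injective S) (exists_label S)
    (columnSum (columnLabel S) * rowSum (rowLabel S))
  simp only [← mul_assoc] at h ⊢
  exact ⟨_, h⟩

theorem cycleSum_label (N : ℕ) :
    cycleSum (rowLabel S) (columnLabel S) (N : ℂ) univ = (boxWeight N S : ℂ) := by
  rw [cycleSum_univ_eq_prod _ (label_injective S) (exists_label S), boxWeight, Int.cast_prod,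
    ← Finset.prod_coe_sort S.1.cells, ← Equiv.prod_comp (tableau S)]
  simp [rowLabel, columnLabel]

end tableau

/-! ## Traces -/

theorem trace_eq_sum_repr {ι V : Type*} [Fintype ι] [AddCommGroup V] [Module ℂ V]
    (b : Basis ι ℂ V) (f : V →ₗ[ℂ] V) : LinearMap.trace ℂ V f = ∑ i, b.repr (f (b i)) i := by
  classical
  rw [LinearMap.trace_eq_matrix_trace ℂ b, Matrix.trace]
  simp [LinearMap.toMatrix_apply]

/-- The trace of a quasi-idempotent operator. -/
theorem trace_eq_mul_finrank_range {V : Type*} [AddCommGroup V] [Module ℂ V]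
    [FiniteDimensional ℂ V] (f : V →ₗ[ℂ] V) (m : ℂ) (h : ∀ v, f (f v) = m • f v) :
    LinearMap.trace ℂ V f = m * (finrank ℂ (LinearMap.range f) : ℂ) := by
  -- If `m = 0` the operator squares to zero and has trace 0; otherwise `m⁻¹ • f` is a projection
  -- onto the range.
  by_cases hm : m = 0
  · have hf : IsNilpotent f := ⟨2, LinearMap.ext fun v => by simp [pow_two, h, hm]⟩
    rw [hm, zero_mul]
    exact (LinearMap.isNilpotent_trace_of_isNilpotent hf).eq_zero
  · have hp : LinearMap.IsProj (LinearMap.range f) (m⁻¹ • f) := by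
      refine ⟨fun v => ⟨m⁻¹ • v, by simp⟩, ?_⟩
      rintro _ ⟨v, rfl⟩
      simp [h, smul_smul, hm]
    have := hp.trace
    rw [map_smul, smul_eq_mul, inv_mul_eq_iff_eq_mul₀ hm] at this
    exact this

theorem trace_piTensorProduct_map {ι : Type*} [Fintype ι] {V : ι → Type*}
    [∀ i, AddCommGroup (V i)] [∀ i, Module ℂ (V i)] [∀ i, FiniteDimensional ℂ (V i)]
    (f : ∀ i, V i →ₗ[ℂ] V i) :
    LinearMap.trace ℂ (⨂[ℂ] i, V i) (PiTensorProduct.map f) =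
      ∏ i, LinearMap.trace ℂ (V i) (f i) := by
  classical
  let b : ∀ i, Basis (Fin (finrank ℂ (V i))) ℂ (V i) := fun i => finBasis ℂ (V i)
  rw [trace_eq_sum_repr (Basis.piTensorProduct b)]
  simp only [trace_eq_sum_repr (b _), Basis.piTensorProduct_apply, PiTensorProduct.map_tprod,
    Basis.piTensorProduct_repr_tprod_apply]
  rw [Finset.prod_univ_sum, Fintype.piFinset_univ]

/-- The standard tensor basis is permuted, so the trace counts the basis labels invariant under
`σ⁻¹`. -/
theorem trace_permTensorRep {n : ℕ} (N : ℕ) (σ : Perm (Fin n)) :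
    LinearMap.trace ℂ (TensorPower n N) (permTensorRep n N σ) = (N : ℂ) ^ cycleCount σ := by
  classical
  rw [trace_eq_sum_repr (Basis.piTensorProduct fun _ => Pi.basisFun ℂ (Fin N)), ← cycleCount_inv,
    ← Nat.cast_pow, ← card_comp_eq_self, Fintype.card_subtype, card_filter, Nat.cast_sum]
  refine sum_congr rfl fun p _ => ?_
  have : permTensorRep n N σ (Basis.piTensorProduct (fun _ => Pi.basisFun ℂ (Fin N)) p) =
      PiTensorProduct.tprod ℂ fun i => Pi.basisFun ℂ (Fin N) (p (σ.symm i)) := by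
    rw [Basis.piTensorProduct_apply]
    exact PiTensorProduct.reindex_tprod σ _
  rw [this, Basis.piTensorProduct_repr_tprod_apply]
  simp only [Pi.basisFun_repr, Pi.basisFun_apply, Pi.single_apply]
  rw [Fintype.prod_ite_zero]
  simp [funext_iff, eq_comm]

theorem trace_asAlgebraHom_youngSymmetrizer {n : ℕ} (N : ℕ) (S : Diagram n) :
    LinearMap.trace ℂ (TensorPower n N)
      ((permTensorRep n N).asAlgebraHom (youngSymmetrizer S)) = (boxWeight N S : ℂ) := by
  rw [← cycleSum_label, youngSymmetrizer_eq, rowSum_mul_columnSum, cycleSum]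
  simp only [map_sum, map_smul, Representation.asAlgebraHom_of, trace_permTensorRep, smul_eq_mul]

theorem trace_mulRight {n : ℕ} (x : ℂ[Perm (Fin n)]) :
    LinearMap.trace ℂ ℂ[Perm (Fin n)] (LinearMap.mulRight ℂ x) = (n ! : ℂ) * x.coeff 1 := by
  rw [trace_eq_sum_repr (MonoidAlgebra.basis (Perm (Fin n)) ℂ)]
  have : ∀ g : Perm (Fin n), (MonoidAlgebra.basis (Perm (Fin n)) ℂ).repr
      (LinearMap.mulRight ℂ x (MonoidAlgebra.basis (Perm (Fin n)) ℂ g)) g = x.coeff 1 := by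
    intro g
    change (MonoidAlgebra.single g 1 * x).coeff g = x.coeff 1
    rw [MonoidAlgebra.coeff_single_mul_apply, inv_mul_cancel, one_mul]
  rw [sum_congr rfl fun g _ => this g]
  simp [Fintype.card_perm]

theorem finrank_range_mulRight_youngSymmetrizer {n : ℕ} (S : Diagram n) :
    finrank ℂ (LinearMap.range (LinearMap.mulRight ℂ (youngSymmetrizer S))) = symDim S := by
  have : LinearMap.range (LinearMap.mulRight ℂ (youngSymmetrizer S)) =
      (Specht S).restrictScalars ℂ := by
    ext x
    rw [LinearMap.mem_range, Submodule.restrictScalars_mem, Ideal.mem_span_singleton']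
    rfl
  rw [this]
  rfl

instance {n : ℕ} : FiniteDimensional ℂ ℂ[Perm (Fin n)] :=
  Module.Finite.of_basis (MonoidAlgebra.basis (Perm (Fin n)) ℂ)

instance {n : ℕ} (S : Diagram n) : FiniteDimensional ℂ (Specht S) :=
  inferInstanceAs (FiniteDimensional ℂ ((Specht S).restrictScalars ℂ))

/-- The same `m` serves both identities: right multiplication by the symmetrizer has the Specht
module as its range, and its action on the tensor power has the `U(N)` representation as its range.
-/
theorem exists_factorial_eq_mul_symDim {n : ℕ} (S : Diagram n) :
    ∃ m : ℂ, (n ! : ℂ) = m * symDim S ∧ ∀ N : ℕ, (boxWeight N S : ℂ) = m * unitaryDim N S := by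
  obtain ⟨m, hm⟩ := youngSymmetrizer_mul_self S
  refine ⟨m, ?_, fun N => ?_⟩
  · rw [← finrank_range_mulRight_youngSymmetrizer, ← trace_eq_mul_finrank_range _ m,
      trace_mulRight, coeff_youngSymmetrizer_one, mul_one]
    intro v
    simp [mul_assoc, hm]
  · rw [← trace_asAlgebraHom_youngSymmetrizer, trace_eq_mul_finrank_range _ m]
    · rfl
    · intro v
      rw [← Module.End.mul_apply, ← map_mul, hm, map_smul, LinearMap.smul_apply]

theorem symDim_ne_zero {n : ℕ} (S : Diagram n) : (symDim S : ℂ) ≠ 0 := by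
  obtain ⟨m, h, -⟩ := exists_factorial_eq_mul_symDim S
  intro h0
  rw [h0, mul_zero] at h
  exact Nat.cast_ne_zero.2 n.factorial_ne_zero h

theorem boxWeight_eq {n : ℕ} (N : ℕ) (S : Diagram n) :
    (boxWeight N S : ℂ) = (n ! : ℂ) * ((unitaryDim N S : ℂ) / (symDim S : ℂ)) := by
  obtain ⟨m, h, h'⟩ := exists_factorial_eq_mul_symDim S
  have := symDim_ne_zero S
  rw [h, h']
  field_simp

/-! ## The central element `∑ N ^ cycleCount τ • τ` -/

/-- The central element `∑ N ^ cycleCount τ • τ` of the group algebra. -/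
def cycleElement (n N : ℕ) : ℂ[Perm (Fin n)] :=
  ∑ τ : Perm (Fin n), (N : ℂ) ^ cycleCount τ • MonoidAlgebra.of ℂ _ τ

/-- The coefficients form a class function, so conjugation only permutes the terms. -/
theorem cycleElement_mul_comm {n : ℕ} (N : ℕ) (x : ℂ[Perm (Fin n)]) :
    cycleElement n N * x = x * cycleElement n N := by
  induction x using MonoidAlgebra.induction_on with
  | of g =>
    simp only [cycleElement, sum_mul, mul_sum, smul_mul_assoc, mul_smul_comm, ← map_mul]
    refine Fintype.sum_equiv (MulAut.conj g⁻¹).toEquiv _ _ fun τ => ?_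
    have h1 : (MulAut.conj g⁻¹).toEquiv τ = g⁻¹ * (τ * g) := by
      simp [mul_assoc]
    rw [h1, cycleCount_mul_comm g⁻¹]
    simp
  | add x y hx hy => rw [mul_add, add_mul, hx, hy]
  | smul t x hx => rw [mul_smul_comm, smul_mul_assoc, hx]

theorem coeff_mul_of_one {n : ℕ} (x : ℂ[Perm (Fin n)]) (g : Perm (Fin n)) :
    (x * MonoidAlgebra.of ℂ _ g).coeff 1 = x.coeff g⁻¹ := by
  rw [MonoidAlgebra.of_apply, MonoidAlgebra.coeff_mul_single_apply, one_mul, mul_one]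

theorem coeff_cycleElement {n : ℕ} (N : ℕ) (g : Perm (Fin n)) :
    (cycleElement n N).coeff g = (N : ℂ) ^ cycleCount g := by
  classical
  simp [cycleElement, MonoidAlgebra.coeff_sum, Finsupp.finsetSum_apply, Finsupp.single_apply]

theorem cycleElement_mul_youngSymmetrizer {n : ℕ} (N : ℕ) (S : Diagram n) :
    cycleElement n N * youngSymmetrizer S = (boxWeight N S : ℂ) • youngSymmetrizer S := by
  have h := rowSum_mul_mul_columnSum (label_injective S) (exists_label S) (cycleElement n N)
  rw [← cycleElement_mul_comm, mul_assoc] at h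
  rw [youngSymmetrizer_eq, h]
  congr 1
  rw [← cycleSum_label, rowSum_mul_columnSum, cycleSum]
  simp only [mul_sum, mul_smul_comm, MonoidAlgebra.coeff_sum, Finsupp.finsetSum_apply,
    MonoidAlgebra.coeff_smul, Finsupp.smul_apply, coeff_mul_of_one, coeff_cycleElement,
    cycleCount_inv, smul_eq_mul]

theorem sum_pow_cycleCount_smul_spechtRep {n : ℕ} (N : ℕ) (S : Diagram n) :
    ∑ τ : Perm (Fin n), (N : ℂ) ^ cycleCount τ • spechtRep S τ = (boxWeight N S : ℂ) • 1 := by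
  refine LinearMap.ext fun v => Subtype.ext ?_
  obtain ⟨y, hy⟩ := Ideal.mem_span_singleton'.1 v.2
  have hτ : ∀ τ : Perm (Fin n), ((spechtRep S τ v : Specht S) : ℂ[Perm (Fin n)]) =
      MonoidAlgebra.of ℂ _ τ * v := fun τ => by
    simp [spechtRep, Representation.ofModule']
  have h : cycleElement n N * (v : ℂ[Perm (Fin n)]) = (boxWeight N S : ℂ) • v := by
    rw [← hy, ← mul_assoc, cycleElement_mul_comm, mul_assoc, cycleElement_mul_youngSymmetrizer,
      mul_smul_comm]
  rw [cycleElement, sum_mul] at h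
  simp only [LinearMap.sum_apply, LinearMap.smul_apply, Submodule.coe_sum, Module.End.one_apply]
  simp only [smul_mul_assoc] at h
  refine Eq.trans (sum_congr rfl fun τ _ => ?_) h
  rw [← hτ]
  rfl

theorem chi_inv {n : ℕ} (S : Diagram n) (σ : Perm (Fin n)) : chi S σ⁻¹ = chi S σ := by
  obtain ⟨g, hg⟩ := isConj_iff.1 (Perm.isConj_iff_cycleType_eq.2 (Perm.cycleType_inv σ))
  rw [chi, ← Representation.char_conj _ σ⁻¹ g, hg, chi]

theorem sum_chi_mul_pow_cycleCount {n : ℕ} (N : ℕ) (S : Diagram n) (γ : Perm (Fin n)) :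
    ∑ σ : Perm (Fin n), chi S σ * (N : ℂ) ^ cycleCount (γ * σ) =
      (boxWeight N S : ℂ) * chi S γ := by
  have h := congrArg (fun f => LinearMap.trace ℂ (Specht S) (spechtRep S γ⁻¹ * f))
    (sum_pow_cycleCount_smul_spechtRep N S)
  simp only [mul_sum, mul_smul_comm, map_sum, map_smul, mul_one, smul_eq_mul, ← map_mul] at h
  rw [← chi_inv, chi, Representation.character, ← h]
  -- The substitution `τ = γ * σ` turns the sum into the trace of `γ⁻¹` times the scalar operator.
  refine Fintype.sum_equiv (Equiv.mulLeft γ) _ _ fun σ => ?_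
  simp [chi, Representation.character, mul_comm]

/-! ## Multiplicities -/

instance {n : ℕ} : Invertible (Nat.card (Perm (Fin n)) : ℂ) :=
  invertibleOfNonzero (Nat.cast_ne_zero.2 Nat.card_pos.ne')

theorem multiKronecker_eq_invariantCount {d n : ℕ} (S : Fin d → Diagram n) :
    multiKronecker S = (invariantCount S : ℂ) := by
  rw [invariantCount, ← Representation.card_inv_mul_sum_char_eq_finrank, multiKronecker,
    Nat.card_eq_fintype_card, Fintype.card_perm, Fintype.card_fin, one_div]
  congr 1
  refine sum_congr rfl fun γ _ => ?_
  exact (trace_piTensorProduct_map fun l => spechtRep (S l) γ).symm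

theorem card_inv_mul_sum_char_tprod {G U V W : Type*} [Group G] [Fintype G]
    [Invertible (Nat.card G : ℂ)] [AddCommGroup U] [Module ℂ U] [FiniteDimensional ℂ U]
    [AddCommGroup V] [Module ℂ V] [FiniteDimensional ℂ V]
    [AddCommGroup W] [Module ℂ W] [FiniteDimensional ℂ W] (ρ : Representation ℂ G U)
    (σ : Representation ℂ G V) (τ : Representation ℂ G W) :
    (Nat.card G : ℂ)⁻¹ * ∑ g : G, ρ.character g * σ.character g * τ.character g⁻¹ =
      (finrank ℂ (Representation.IntertwiningMap τ (ρ.tprod σ)) : ℂ) := by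
  have h := Representation.card_inv_mul_sum_char_mul_char_eq_finrank (W := U ⊗[ℂ] V) τ (ρ.tprod σ)
  simpa only [Representation.char_tensor, Pi.mul_apply] using h

theorem multiKronecker_eq_kronecker {n : ℕ} (S : Fin 3 → Diagram n) :
    multiKronecker S = (kronecker (S 0) (S 1) (S 2) : ℂ) := by
  refine Eq.trans ?_ (card_inv_mul_sum_char_tprod (spechtRep (S 0)) (spechtRep (S 1))
    (spechtRep (S 2)))
  rw [multiKronecker, Nat.card_eq_fintype_card, Fintype.card_perm, Fintype.card_fin, one_div]
  congr 1
  refine sum_congr rfl fun γ _ => ?_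
  rw [Fin.prod_univ_three, ← chi_inv (S 2)]
  rfl

/-! ## Gaussian integrals in one complex variable -/

/-- The integrand `z ^ m * conj z ^ k * exp (-|z| ^ 2)`. -/
def gaussianMonomial (m k : ℕ) (z : ℂ) : ℂ :=
  z ^ m * starRingEnd ℂ z ^ k * (Real.exp (-‖z‖ ^ 2) : ℂ)

theorem integral_norm_pow_mul_exp (q : ℕ) :
    ∫ z : ℂ, ‖z‖ ^ q * Real.exp (-‖z‖ ^ 2) = Real.pi * Real.Gamma ((q + 2) / 2) := by
  have h := Complex.integral_rpow_mul_exp_neg_rpow (p := 2) (q := q) one_le_two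
    (by linarith [(Nat.cast_nonneg q : (0 : ℝ) ≤ q)])
  rw [mul_div_cancel_left₀ _ two_ne_zero] at h
  rw [← h]
  norm_cast

/-- The Bochner integral of a non-integrable function is 0 by convention, while the value here is a
positive multiple of a Gamma value. -/
theorem integrable_norm_pow_mul_exp (q : ℕ) :
    Integrable fun z : ℂ => ‖z‖ ^ q * Real.exp (-‖z‖ ^ 2) := by
  by_contra h
  have h0 := integral_undef h
  rw [integral_norm_pow_mul_exp] at h0
  exact (mul_pos Real.pi_pos (Real.Gamma_pos_of_pos (by positivity))).ne' h0

theorem integrable_gaussianMonomial (m k : ℕ) : Integrable (gaussianMonomial m k) := by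
  refine (integrable_norm_pow_mul_exp (m + k)).mono' ?_ (Filter.Eventually.of_forall fun z => ?_)
  · refine Continuous.aestronglyMeasurable ?_
    unfold gaussianMonomial
    fun_prop
  · rw [gaussianMonomial, norm_mul, norm_mul, norm_pow, norm_pow, RCLike.norm_conj, ← pow_add,
      Complex.norm_real, Real.norm_eq_abs, Real.abs_exp]

theorem integral_gaussianMonomial_self (m : ℕ) :
    ∫ z, gaussianMonomial m m z = (Real.pi : ℂ) * (m ! : ℂ) := by
  have h : ∀ z, gaussianMonomial m m z =
      ((‖z‖ ^ (2 * m) * Real.exp (-‖z‖ ^ 2) : ℝ) : ℂ) := by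
    intro z
    rw [gaussianMonomial, ← mul_pow, Complex.mul_conj, Complex.normSq_eq_norm_sq, pow_mul]
    push_cast
    rfl
  simp only [h]
  rw [integral_complex_ofReal, integral_norm_pow_mul_exp]
  have : (((2 * m : ℕ) : ℝ) + 2) / 2 = m + 1 := by
    push_cast
    ring
  rw [this, Real.Gamma_nat_eq_factorial]
  push_cast
  rfl

theorem integral_gaussianMonomial_of_ne {m k : ℕ} (hmk : m ≠ k) :
    ∫ z, gaussianMonomial m k z = 0 := by
  have hne : ((m : ℝ) - k) ≠ 0 := sub_ne_zero.2 (Nat.cast_injective.ne hmk)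
  -- Rotation by this angle preserves Lebesgue measure and multiplies the integrand by `exp (i π) =
  -- -1`.
  let u : Circle := Circle.exp (Real.pi / (m - k))
  have hu : (u : ℂ) ^ m * starRingEnd ℂ (u : ℂ) ^ k = -1 := by
    rw [← Circle.coe_inv_eq_conj, ← Circle.coe_pow, ← Circle.coe_pow, ← Circle.coe_mul, inv_pow,
      ← div_eq_mul_inv, ← Circle.exp_natCast_mul, ← Circle.exp_natCast_mul, ← Circle.exp_sub,
      ← sub_mul, mul_div_cancel₀ _ hne]
    simp
  have h1 := (rotation u).measurePreserving.integral_comp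
    (rotation u).toHomeomorph.measurableEmbedding (gaussianMonomial m k)
  have h2 : ∀ z, gaussianMonomial m k (rotation u z) = -gaussianMonomial m k z := by
    intro z
    rw [gaussianMonomial, gaussianMonomial, rotation_apply, map_mul, mul_pow, mul_pow, norm_mul,
      Circle.norm_coe, one_mul]
    linear_combination (z ^ m * starRingEnd ℂ z ^ k * (Real.exp (-‖z‖ ^ 2) : ℂ)) * hu
  simp only [h2, integral_neg] at h1
  exact self_eq_neg.1 h1.symm

/-! ## The Wick formula -/

section wick

variable {ι : Type*} [Fintype ι] [DecidableEq ι] {n : ℕ}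

/-- If all fibres of `I` and `J` match in size, the solutions form a coset of the stabilizer of `I`,
a product of symmetric groups on its fibres. Otherwise there are none. The factors are the
one-variable Gaussian moments divided by `π`. -/
theorem card_comp_eq (I J : Fin n → ι) :
    (Fintype.card {γ : Perm (Fin n) // J ∘ γ = I} : ℂ) =
      ∏ x, if #{a | I a = x} = #{a | J a = x} then ((#{a | I a = x})! : ℂ) else 0 := by
  by_cases h : ∀ x, #{a | I a = x} = #{a | J a = x}
  · have e : ∀ x, {a // I a = x} ≃ {a // J a = x} := fun x =>
      Fintype.equivOfCardEq (by simpa only [Fintype.card_subtype] using h x)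
    let γ₀ : Perm (Fin n) := Equiv.ofFiberEquiv e
    have hγ₀ : ∀ a, J (γ₀ a) = I a := Equiv.ofFiberEquiv_map e
    have hc : Fintype.card {γ : Perm (Fin n) // J ∘ γ = I} =
        Fintype.card {g : Perm (Fin n) // I ∘ g = I} := by
      refine Fintype.card_congr (Equiv.subtypeEquiv (Equiv.mulLeft γ₀⁻¹) fun γ => ?_)
      have : I ∘ (Equiv.mulLeft γ₀⁻¹ γ) = J ∘ γ := by
        funext a
        simp [← hγ₀]
      rw [this]
    rw [hc, DomMulAct.stabilizer_card, Nat.cast_prod]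
    refine prod_congr rfl fun x _ => ?_
    rw [if_pos (h x), Fintype.card_subtype]
  · push Not at h
    obtain ⟨x, hx⟩ := h
    rw [prod_eq_zero (mem_univ x) (if_neg hx), Nat.cast_eq_zero, Fintype.card_eq_zero_iff]
    refine ⟨fun γ => hx ?_⟩
    refine card_bij (fun a _ => γ.1 a) (fun a ha => ?_) (by simp) fun b hb => ?_
    · simpa [← γ.2] using ha
    · exact ⟨γ.1.symm b, by simpa [← γ.2] using hb, by simp⟩

theorem prod_mul_conj_mul_weight (I J : Fin n → ι) (Φ : ι → ℂ) :
    (∏ a, (Φ (I a) * starRingEnd ℂ (Φ (J a)))) * (Real.exp (-∑ x, ‖Φ x‖ ^ 2) : ℂ) =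
      ∏ x, gaussianMonomial #{a | I a = x} #{a | J a = x} (Φ x) := by
  simp only [gaussianMonomial, prod_mul_distrib]
  rw [← Finset.prod_fiberwise' univ I,
    ← Finset.prod_fiberwise' univ J (fun x => starRingEnd ℂ (Φ x))]
  simp only [prod_const]
  rw [← sum_neg_distrib, Real.exp_sum, Complex.ofReal_prod]

theorem integrable_prod_mul_conj (I J : Fin n → ι) :
    Integrable fun Φ : ι → ℂ =>
      (∏ a, (Φ (I a) * starRingEnd ℂ (Φ (J a)))) * (Real.exp (-∑ x, ‖Φ x‖ ^ 2) : ℂ) := by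
  simp only [prod_mul_conj_mul_weight]
  exact Integrable.fintype_prod fun x => integrable_gaussianMonomial _ _

theorem integral_prod_mul_conj (I J : Fin n → ι) :
    ∫ Φ : ι → ℂ, (∏ a, (Φ (I a) * starRingEnd ℂ (Φ (J a)))) *
        (Real.exp (-∑ x, ‖Φ x‖ ^ 2) : ℂ) =
      (Real.pi : ℂ) ^ Fintype.card ι * Fintype.card {γ : Perm (Fin n) // J ∘ γ = I} := by
  simp only [prod_mul_conj_mul_weight]
  rw [integral_fintype_prod_volume_eq_prod
    (fun x => gaussianMonomial #{a | I a = x} #{a | J a = x}), card_comp_eq, ← card_univ,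
    ← prod_const, ← prod_mul_distrib]
  refine prod_congr rfl fun x _ => ?_
  split_ifs with h
  · rw [← h, integral_gaussianMonomial_self]
  · rw [integral_gaussianMonomial_of_ne h, mul_zero]

end wick

/-! ### Expectations of the tensor observables -/

variable {d N : ℕ}

theorem integral_gaussianWeight :
    ∫ Φ : Tensor d N, (gaussianWeight Φ : ℂ) =
      (Real.pi : ℂ) ^ Fintype.card (Fin d → Fin N) := by
  -- The normalisation is the case of the empty monomial.
  have h := integral_prod_mul_conj (n := 0) (ι := Fin d → Fin N) Fin.elim0 Fin.elim0
  have hc : Fintype.card {γ : Perm (Fin 0) //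
      (Fin.elim0 : Fin 0 → Fin d → Fin N) ∘ γ = Fin.elim0} = 1 :=
    Fintype.card_eq_one_iff.2 ⟨⟨1, Subsingleton.elim _ _⟩, fun _ => Subsingleton.elim _ _⟩
  simpa [hc, gaussianWeight] using h

theorem integral_gaussianWeight_ne_zero : ∫ Φ : Tensor d N, (gaussianWeight Φ : ℂ) ≠ 0 := by
  rw [integral_gaussianWeight]
  exact pow_ne_zero _ (Complex.ofReal_ne_zero.2 Real.pi_ne_zero)

theorem integral_gaussianWeight_pos : 0 < ∫ Φ : Tensor d N, gaussianWeight Φ := by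
  have h := integral_gaussianWeight (d := d) (N := N)
  rw [integral_complex_ofReal] at h
  have h' : ∫ Φ : Tensor d N, gaussianWeight Φ = Real.pi ^ Fintype.card (Fin d → Fin N) := by
    exact_mod_cast h
  rw [h']
  exact pow_pos Real.pi_pos _

theorem gaussianIntegrable_one : GaussianIntegrable (fun _ : Tensor d N => 1) := by
  have h := integrable_prod_mul_conj (n := 0) (ι := Fin d → Fin N) Fin.elim0 Fin.elim0
  simpa [GaussianIntegrable, gaussianWeight] using h

theorem gaussianIntegrable_prod_mul_conj {n : ℕ} (I J : Fin n → Fin d → Fin N) :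
    GaussianIntegrable (fun Φ : Tensor d N => ∏ a, (Φ (I a) * starRingEnd ℂ (Φ (J a)))) :=
  integrable_prod_mul_conj I J

/-- Wick's theorem for a monomial. -/
theorem expectation_prod_mul_conj {n : ℕ} (I J : Fin n → Fin d → Fin N) :
    expectation (fun Φ : Tensor d N => ∏ a, (Φ (I a) * starRingEnd ℂ (Φ (J a)))) =
      Fintype.card {γ : Perm (Fin n) // J ∘ γ = I} := by
  rw [expectation, div_eq_iff integral_gaussianWeight_ne_zero, integral_gaussianWeight, mul_comm]
  exact integral_prod_mul_conj I J

section linearity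

variable {κ : Type*} {s : Finset κ} {F : κ → Tensor d N → ℂ}

theorem GaussianIntegrable.sum (h : ∀ i ∈ s, GaussianIntegrable (F i)) :
    GaussianIntegrable (fun Φ => ∑ i ∈ s, F i Φ) := by
  simp only [GaussianIntegrable, sum_mul]
  exact integrable_finsetSum _ h

theorem GaussianIntegrable.const_mul {G : Tensor d N → ℂ} (h : GaussianIntegrable G) (t : ℂ) :
    GaussianIntegrable (fun Φ => t * G Φ) := by
  simp only [GaussianIntegrable, mul_assoc]
  exact Integrable.const_mul h t

theorem expectation_sum (h : ∀ i ∈ s, GaussianIntegrable (F i)) :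
    expectation (fun Φ => ∑ i ∈ s, F i Φ) = ∑ i ∈ s, expectation (F i) := by
  simp only [expectation, sum_mul]
  rw [integral_finsetSum _ h, sum_div]

theorem expectation_const_mul (G : Tensor d N → ℂ) (t : ℂ) :
    expectation (fun Φ => t * G Φ) = t * expectation G := by
  simp only [expectation, mul_assoc, integral_const_mul, mul_div_assoc]

end linearity

variable {n : ℕ}

theorem gaussianIntegrable_permObservable (σ : Fin d → Perm (Fin n)) :
    GaussianIntegrable (permObservable (N := N) σ) :=
  GaussianIntegrable.sum fun i _ =>
    gaussianIntegrable_prod_mul_conj (fun a l => i l a) (fun a l => i l (σ l a))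

theorem card_forall_comp_eq (τ : Fin d → Perm (Fin n)) :
    Fintype.card {i : Fin d → Fin n → Fin N // ∀ l, i l ∘ τ l = i l} =
      N ^ ∑ l, cycleCount (τ l) := by
  rw [Fintype.card_congr (Equiv.subtypePiEquivPi (p := fun l (f : Fin n → Fin N) => f ∘ τ l = f)),
    Fintype.card_pi, ← prod_pow_eq_pow_sum]
  exact prod_congr rfl fun l _ => card_comp_eq_self (τ l) N

theorem expectation_permObservable (σ : Fin d → Perm (Fin n)) :
    expectation (permObservable (N := N) σ) =
      ∑ γ : Perm (Fin n), (N : ℂ) ^ ∑ l, cycleCount (γ * σ l) := by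
  have h : expectation (permObservable (N := N) σ) = ∑ i : Fin d → Fin n → Fin N,
      expectation (fun Φ : Tensor d N =>
        ∏ a, (Φ (fun l => i l a) * starRingEnd ℂ (Φ (fun l => i l (σ l a))))) :=
    expectation_sum fun i _ =>
      gaussianIntegrable_prod_mul_conj (fun a l => i l a) (fun a l => i l (σ l a))
  rw [h, sum_congr rfl fun i _ => expectation_prod_mul_conj (fun a l => i l a)
    (fun a l => i l (σ l a))]
  simp only [Fintype.card_subtype, card_filter, Nat.cast_sum]
  -- With `γ` outermost, the inner sum counts the index functions with each `i l` invariant under `σ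
  -- l * γ`, independently in each `l`.
  rw [sum_comm]
  refine sum_congr rfl fun γ _ => ?_
  rw [← Nat.cast_sum, ← card_filter, ← Fintype.card_subtype]
  simp only [cycleCount_mul_comm γ]
  rw [← Nat.cast_pow, ← card_forall_comp_eq]
  congr 1
  refine Fintype.card_congr (Equiv.subtypeEquivRight fun i => ?_)
  simp only [funext_iff, Function.comp_apply, Perm.mul_apply]
  exact forall_comm

theorem gaussianIntegrable_charObservable (S : Fin d → Diagram n) :
    GaussianIntegrable (charObservable (N := N) S) :=
  (GaussianIntegrable.sum fun σ _ =>
    (gaussianIntegrable_permObservable σ).const_mul (∏ l, chi (S l) (σ l))).const_mul _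

theorem expectation_charObservable (S : Fin d → Diagram n) :
    expectation (charObservable (N := N) S) =
      1 / (n ! : ℂ) ^ d * ∑ σ : Fin d → Perm (Fin n),
        (∏ l, chi (S l) (σ l)) * expectation (permObservable (N := N) σ) := by
  refine (expectation_const_mul _ _).trans (congrArg _ ?_)
  refine (expectation_sum fun σ _ => (gaussianIntegrable_permObservable σ).const_mul _).trans ?_
  exact sum_congr rfl fun σ _ => expectation_const_mul _ _

theorem expectation_charObservable_eq_boxWeight (S : Fin d → Diagram n) :
    expectation (charObservable (N := N) S) =
      1 / (n ! : ℂ) ^ d * ((∏ l, (boxWeight N (S l) : ℂ)) * ((n ! : ℂ) * multiKronecker S)) := by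
  have hn : (n ! : ℂ) ≠ 0 := Nat.cast_ne_zero.2 n.factorial_ne_zero
  rw [expectation_charObservable]
  congr 1
  simp only [expectation_permObservable, mul_sum]
  rw [sum_comm, multiKronecker, one_div, mul_inv_cancel_left₀ hn, mul_sum]
  refine sum_congr rfl fun γ _ => ?_
  rw [← prod_mul_distrib, ← prod_congr rfl fun l _ => sum_chi_mul_pow_cycleCount N (S l) γ,
    prod_univ_sum, Fintype.piFinset_univ]
  refine sum_congr rfl fun σ _ => ?_
  rw [prod_mul_distrib, prod_pow_eq_pow_sum]

theorem expectation_charObservable_eq_dim (S : Fin d → Diagram n) :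
    expectation (charObservable (N := N) S) =
      (n ! : ℂ) * (∏ l, (unitaryDim N (S l) : ℂ) / (symDim (S l) : ℂ)) * multiKronecker S := by
  have hn : (n ! : ℂ) ≠ 0 := Nat.cast_ne_zero.2 n.factorial_ne_zero
  rw [expectation_charObservable_eq_boxWeight]
  simp only [boxWeight_eq, prod_mul_distrib, prod_const, card_univ, Fintype.card_fin]
  field_simp

end

end TensorModel

theorem mainTheorem9 (n N : ℕ) :
    -- every rank `d`
    (∀ d : ℕ,
      -- the Gaussian measure is finite and not zero
      GaussianIntegrable (fun _ : Tensor d N => 1) ∧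
      0 < (∫ Φ : Tensor d N, gaussianWeight Φ) ∧
      -- Wick formula
      (∀ σ : Fin d → Equiv.Perm (Fin n),
        GaussianIntegrable (permObservable (N := N) σ) ∧
        expectation (permObservable (N := N) σ) =
          ∑ γ : Equiv.Perm (Fin n), (N : ℂ) ^ (∑ l, cycleCount (γ * σ l))) ∧
      -- character-weighted observables
      (∀ S : Fin d → Diagram n,
        GaussianIntegrable (charObservable (N := N) S) ∧
        expectation (charObservable (N := N) S) =
          1 / (n.factorial : ℂ) ^ d * ∑ σ : Fin d → Equiv.Perm (Fin n),
            (∏ l, chi (S l) (σ l)) *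
              expectation (permObservable (N := N) σ) ∧
        expectation (charObservable (N := N) S) =
          (n.factorial : ℂ) *
            (∏ l, (unitaryDim N (S l) : ℂ) / (symDim (S l) : ℂ)) *
            multiKronecker S ∧
        multiKronecker S = (invariantCount S : ℂ))) ∧
    -- rank three
    (∀ S : Fin 3 → Diagram n,
      multiKronecker S = (kronecker (S 0) (S 1) (S 2) : ℂ) ∧
      expectation (charObservable (N := N) S) =
        (n.factorial : ℂ) *
          (∏ l, (unitaryDim N (S l) : ℂ) / (symDim (S l) : ℂ)) *
          (kronecker (S 0) (S 1) (S 2) : ℂ) ∧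
      expectation (charObservable (N := N) S) =
        1 / (n.factorial : ℂ) ^ 2 * (∏ l, (boxWeight N (S l) : ℂ)) *
          (kronecker (S 0) (S 1) (S 2) : ℂ)) := by
  refine ⟨fun d => ⟨gaussianIntegrable_one, integral_gaussianWeight_pos,
    fun σ => ⟨gaussianIntegrable_permObservable σ, expectation_permObservable σ⟩,
    fun S => ⟨gaussianIntegrable_charObservable S, expectation_charObservable S,
      expectation_charObservable_eq_dim S, multiKronecker_eq_invariantCount S⟩⟩,
    fun S => ⟨multiKronecker_eq_kronecker S, ?_, ?_⟩⟩
  · rw [expectation_charObservable_eq_dim, multiKronecker_eq_kronecker]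
  · have hn : (n.factorial : ℂ) ≠ 0 := Nat.cast_ne_zero.2 n.factorial_ne_zero
    rw [expectation_charObservable_eq_boxWeight, multiKronecker_eq_kronecker]
    field_simp
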